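/- Let $M$ be a compact Hausdorff manifold with a foliation $\mathcal L$ of dimension $p$ and codimension $q$ (no differentiability is needed; smooth foliations are included), and let $L_0$ be a compact leaf, $x_0\in L_0$. Let $T\ni x_0$ be a compact connected transversal of $\mathcal L$ at $x_0$ (possibly with boundary), and let $V$ be a neighbourhood of $L_0$ presented by Haefliger's suspension: $V$ is the image of a continuous map $\Phi:\hat L_0\times T\to M$, where $\hat L_0\to L_0$ is the universal covering, the fibres of $\Phi$ are the orbits of the diagonal action of $\pi_1(L_0,x_0)$ by deck transformations on $\hat L_0$ and by the holonomy on $T$, $\Phi$ restricts to the inclusion $T\subset M$ over a point $\hat x_0$ above $x_0$ and to the covering $\hat L_0\to L_0$ on $\hat L_0\times\{x_0\}$, and $\Phi$ maps each slice $\hat L_0\times\{t\}$ locally homeomorphically into a leaf of $\mathcal L$ with its leaf topology. Then $\pi_1(L_0,x_0)$ is finitely generated, and the growth of every leaf $L_1$ of $\mathcal L$ that meets $V$ is bounded above by the growth of $\pi_1(L_0,x_0)$. That is: let $(U_i)_{i\in I}$ be a finite regular foliated atlas of $M$, i.e. a finite open cover by domains $U_i=\varphi_i^{-1}(A_i\times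 B_i)$, where the $\varphi_i$ are foliated charts with values in $\mathbb R^p\times\mathbb R^q$, $A_i\subset\mathbb R^p$ is open and connected, $B_i\subset\mathbb R^q$ is open, and $\overline{A_i}\times\overline{B_i}$ is compact and contained in the image of $\varphi_i$. A plaque of $L_1$ is a connected component (for the leaf topology) of some $L_1\cap U_i$, and a path of plaques of length $l$ is a sequence $(P_1,\dots,P_l)$ of plaques of $L_1$ with $P_j\cap P_{j+1}\neq\emptyset$ for $1\le j<l$. For a plaque $P$ of $L_1$ let $\gamma_P(n)$ be the number of plaques that can be joined to $P$ by a path of plaques of length at most $n$. For a finite generating set $S$ of $\pi_1(L_0,x_0)$ let $\beta_S(n)$ be the number of elements that are products of at most $n$ elements of $S\cup S^{-1}$. Then for every such atlas, every plaque $P$ of $L_1$ and every $S$ there are $a,b\in\mathbb N$ with $$\gamma_P(n)\le a\,\beta_S(bn)\qquad\text{for all } n\in\mathbb N .$$ -/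

import Mathlib

open Set Filter Topology
open scoped Pointwise

/-- Euclidean space `ℝⁿ`. -/
abbrev Eucl (n : ℕ) : Type := EuclideanSpace ℝ (Fin n)

section Foliations

variable {p q : ℕ} {M : Type*} [TopologicalSpace M]

/-- Two charts `φ = (leaf coordinate, transverse coordinate)` and `ψ` with values in `ℝᵖ × ℝ^q`
define the same local leaves on the overlap of their domains: near each common point, two points
have the same transverse coordinate for `φ` iff they have the same transverse coordinate for `ψ`.
Equivalently, the coordinate change is locally of the form `(u, v) ↦ (h₁(u, v), h₂(v))`. -/
def LeafCompatible (φ ψ : OpenPartialHomeomorph M (Eucl p × Eucl q)) : Prop :=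
  ∀ x ∈ φ.source ∩ ψ.source, ∃ U ∈ 𝓝 x, ∀ y ∈ U, ∀ z ∈ U,
    ((φ y).2 = (φ z).2 ↔ (ψ y).2 = (ψ z).2)

/-- A foliation of dimension `p` and codimension `q` on `M`, given by a foliated atlas. The charts
of the atlas also make `M` locally Euclidean of dimension `p + q`. No differentiability of the
coordinate changes is required, so that foliations of every smoothness class are included. -/
structure Foliation (p q : ℕ) (M : Type*) [TopologicalSpace M] where
  charts : Set (OpenPartialHomeomorph M (Eucl p × Eucl q))
  cover : ∀ x : M, ∃ φ ∈ charts, x ∈ φ.source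
  compatible : ∀ φ ∈ charts, ∀ ψ ∈ charts, LeafCompatible φ ψ

namespace Foliation

/-- `φ` is a foliated chart: it belongs to the maximal foliated atlas of `F`. -/
def IsFoliatedChart (F : Foliation p q M)
    (φ : OpenPartialHomeomorph M (Eucl p × Eucl q)) : Prop :=
  ∀ ψ ∈ F.charts, LeafCompatible φ ψ

/-- A copy of `M`, which carries the leaf topology. -/
def Leafwise (_F : Foliation p q M) : Type _ := M

/-- The identity map from `M` to the copy of `M` that carries the leaf topology. -/
def toLeafwise (F : Foliation p q M) : M ≃ F.Leafwise := Equiv.refl M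

/-- The leaf topology: a set is open iff with each of its points it contains a small piece of the
local leaf through that point. -/
instance (F : Foliation p q M) : TopologicalSpace F.Leafwise where
  IsOpen W := ∀ x : M, F.toLeafwise x ∈ W → ∀ φ ∈ F.charts, x ∈ φ.source →
    ∀ᶠ y in 𝓝 x, (φ y).2 = (φ x).2 → F.toLeafwise y ∈ W
  isOpen_univ := by
    intro x _ φ _ _
    exact Eventually.of_forall fun _ _ => mem_univ _
  isOpen_inter := by
    intro V W hV hW x hx φ hφ hxφ
    filter_upwards [hV x hx.1 φ hφ hxφ, hW x hx.2 φ hφ hxφ] with y h1 h2 h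
    exact ⟨h1 h, h2 h⟩
  isOpen_sUnion := by
    intro 𝒲 h𝒲 x hx φ hφ hxφ
    obtain ⟨W, hW, hxW⟩ := hx
    filter_upwards [h𝒲 W hW x hxW φ hφ hxφ] with y h1 h
    exact ⟨W, hW, h1 h⟩

/-- The leaf through `x`, as a space with the leaf topology: the path component of `x` for the
leaf topology. -/
abbrev Leaf (F : Foliation p q M) (x : M) : Type _ :=
  ↥(pathComponent (F.toLeafwise x))

/-- The leaf through `x`, as a subset of `M`. -/
def leaf (F : Foliation p q M) (x : M) : Set M :=
  F.toLeafwise ⁻¹' pathComponent (F.toLeafwise x)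

/-- The point `x` of the leaf through `x`. -/
def basePoint (F : Foliation p q M) (x : M) : F.Leaf x :=
  ⟨F.toLeafwise x, mem_pathComponent_self _⟩

/-- The point of `M` underlying a point of a leaf. -/
def Leaf.val (F : Foliation p q M) {x : M} (y : F.Leaf x) : M := F.toLeafwise.symm y.1

/-- `T` is a (local, topological) transversal at `x₀`: it contains `x₀`, near each of its points it
meets each local leaf at most once, and near `x₀` it meets all local leaves close to that of `x₀`
(so it has the full dimension `q` there). A boundary of `T` is allowed. -/
structure IsTransversalAt (F : Foliation p q M) (T : Set M) (x₀ : M) : Prop where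
  mem : x₀ ∈ T
  injOn : ∀ x ∈ T, ∃ φ, F.IsFoliatedChart φ ∧ x ∈ φ.source ∧
    InjOn (fun y => (φ y).2) (T ∩ φ.source)
  nhds : ∃ φ, F.IsFoliatedChart φ ∧ x₀ ∈ φ.source ∧
    (fun y => (φ y).2) '' (T ∩ φ.source) ∈ 𝓝 (φ x₀).2

/-- Haefliger's suspension: a presentation of a neighbourhood of the leaf `L₀` of `x₀` as the
quotient of `X × T` by `π₁(L₀, x₀)`, where `X` (to be taken simply connected) is the universal
covering space of `L₀`, the group acts on `X` by deck transformations and on the transversal `T`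
by the holonomy, and the leaves of `F` in that neighbourhood are given by the slices `X × {t}`. -/
structure HaefligerSuspension (F : Foliation p q M) (x₀ : M) (T : Set M)
    (X : Type*) [TopologicalSpace X] where
  /-- the universal covering map -/
  cov : X → F.Leaf x₀
  isCoveringMap : IsCoveringMap cov
  /-- a point of `X` above `x₀` -/
  base : X
  cov_base : cov base = F.basePoint x₀
  /-- the action of `π₁(L₀, x₀)` on `X` by deck transformations -/
  deck : FundamentalGroup (F.Leaf x₀) (F.basePoint x₀) →* (X ≃ₜ X)
  cov_deck : ∀ g x, cov (deck g x) = cov x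
  /-- The deck transformation of the class of a loop `γ` takes the end point of the lift of `γ`
  from `base` back to `base`. (In Mathlib, `[γ] * [δ]` is the class of `δ` followed by `γ`, and
  with this convention one gets a homomorphism.) -/
  deck_lift : ∀ (x : X) (c : Path base x) (γ : Path (F.basePoint x₀) (F.basePoint x₀)),
    (∀ s, cov (c s) = γ s) →
      deck (FundamentalGroup.fromPath (Path.Homotopic.Quotient.mk γ)) x = base
  /-- The action of `π₁(L₀, x₀)` on `T`. The fields below force `hol [γ]` to be the holonomy
  along `γ`: the lift `c` of `γ` from `base` to `x` gives the path `s ↦ toM (c s, t)` in a leaf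
  from `t` to `toM (x, t) = toM (base, hol [γ] t) = hol [γ] t`. -/
  hol : FundamentalGroup (F.Leaf x₀) (F.basePoint x₀) →* (T ≃ₜ T)
  /-- the projection of `X × T` to its quotient, which is a neighbourhood of `L₀` in `M` -/
  toM : X × T → M
  continuous_toM : Continuous toM
  /-- `T` is the slice over `base` -/
  toM_base : ∀ t : T, toM (base, t) = t
  /-- the slice `X × {x₀}` covers `L₀` by `cov` -/
  toM_leaf : ∀ (x : X) (t : T), (t : M) = x₀ → toM (x, t) = Leaf.val F (cov x)
  /-- the fibres of the projection are the orbits of the diagonal action -/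
  toM_eq_iff : ∀ (x y : X) (s t : T),
    toM (x, s) = toM (y, t) ↔ ∃ g, y = deck g x ∧ t = hol g s
  /-- each slice `X × {t}` is carried locally homeomorphically to a leaf (for the leaf topology) -/
  slice_isLocalHomeomorph : ∀ t : T,
    IsLocalHomeomorph (fun x : X => F.toLeafwise (toM (x, t)))
  /-- the image is a neighbourhood of `L₀` -/
  range_mem_nhdsSet : range toM ∈ 𝓝ˢ (F.leaf x₀)

/-- The neighbourhood of `L₀` presented by Haefliger's suspension. -/
def HaefligerSuspension.nbhd {F : Foliation p q M} {x₀ : M} {T : Set M}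
    {X : Type*} [TopologicalSpace X] (H : F.HaefligerSuspension x₀ T X) : Set M :=
  range H.toM

/-- A regular foliated atlas: domains `Uᵢ = φᵢ⁻¹(Aᵢ × Bᵢ)`, where `Aᵢ` is open and connected, `Bᵢ`
is open, and the closed boxes are compact and contained in the targets of the foliated charts
`φᵢ`. The foliation induced on `Uᵢ` is simple, with space of leaves `Bᵢ`. -/
structure RegularAtlas (F : Foliation p q M) (ι : Type*) where
  chart : ι → OpenPartialHomeomorph M (Eucl p × Eucl q)
  foliated : ∀ i, F.IsFoliatedChart (chart i)
  A : ι → Set (Eucl p)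
  B : ι → Set (Eucl q)
  isOpen_A : ∀ i, IsOpen (A i)
  isConnected_A : ∀ i, IsConnected (A i)
  isOpen_B : ∀ i, IsOpen (B i)
  isCompact_A : ∀ i, IsCompact (closure (A i))
  isCompact_B : ∀ i, IsCompact (closure (B i))
  closure_subset : ∀ i, closure (A i) ×ˢ closure (B i) ⊆ (chart i).target
  cover : ∀ x : M, ∃ i, x ∈ (chart i).source ∧ chart i x ∈ A i ×ˢ B i

namespace RegularAtlas

variable {F : Foliation p q M} {ι : Type*}

/-- The domain `Uᵢ`. -/
def dom (𝒰 : F.RegularAtlas ι) (i : ι) : Set M :=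
  {x | x ∈ (𝒰.chart i).source ∧ 𝒰.chart i x ∈ 𝒰.A i ×ˢ 𝒰.B i}

/-- `P` is a plaque of the leaf `L`: a connected component of some `L ∩ Uᵢ`, for the leaf
topology. -/
def IsPlaque (𝒰 : F.RegularAtlas ι) (L P : Set M) : Prop :=
  ∃ i, ∃ x ∈ L ∩ 𝒰.dom i,
    P = F.toLeafwise ⁻¹'
      connectedComponentIn (F.toLeafwise '' (L ∩ 𝒰.dom i)) (F.toLeafwise x)

/-- `c` is a path of plaques of the leaf `L`: consecutive plaques meet. Its length is the number of
its plaques. -/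
def IsPlaquePath (𝒰 : F.RegularAtlas ι) (L : Set M) (c : List (Set M)) : Prop :=
  (∀ Q ∈ c, 𝒰.IsPlaque L Q) ∧ c.IsChain (fun Q R => (Q ∩ R).Nonempty)

/-- The growth function of the leaf `L` at the plaque `P`: the number of plaques that can be joined
to `P` by a path of plaques of `L` of length at most `n`. -/
noncomputable def growth (𝒰 : F.RegularAtlas ι) (L P : Set M) (n : ℕ) : ℕ∞ :=
  {Q : Set M | ∃ c : List (Set M), 𝒰.IsPlaquePath L c ∧ c.length ≤ n ∧
    c.head? = some P ∧ c.getLast? = some Q}.encard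

end RegularAtlas

end Foliation

end Foliations

/-- The growth function of a group with respect to a generating set `S`: the number of elements
that are products of at most `n` elements of `S ∪ S⁻¹`. -/
noncomputable def wordGrowth {G : Type*} [Group G] (S : Set G) (n : ℕ) : ℕ∞ :=
  ((insert 1 (S ∪ S⁻¹) : Set G) ^ n).encard

/-- The growth of `f` is bounded above by the growth of `g`. -/
def GrowthLE (f g : ℕ → ℕ∞) : Prop :=
  ∃ a b : ℕ, ∀ n : ℕ, f n ≤ (a : ℕ∞) * g (b * n)

/-! The leaf through `toM (u, t)` is the image of the slice `X × {t}`, and `X` is tiled by the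
translates of a compact set `K` under the deck group `G = π₁(L₀, x₀)`. Up to bounded error, moving
from plaque to plaque in the leaf is therefore moving from tile to tile, that is, multiplying by
elements of a finite subset of `G`.

Two uniform bounds make this precise. First, there is a finite `A ⊆ G` such that, if a point of a
plaque has a preimage in `gK × {t}`, every other point of that plaque has one in `gaK × {t}` for
some `a ∈ A` (`exists_transport_plaque`). Second, the image of one tile meets at most `N` plaques
(`exists_encard_plaques_le`). Both are compactness statements about `K × T`: by `toM_deck` the image
of `gK × {t}` is that of `K × {hol g⁻¹ t}`, so bounds uniform over `T` hold for every tile. The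
local input is `exists_uniform_open`: nearby slices cover local leaves of a uniform size.

A path of `n` plaques from `P` thus ends at a plaque meeting a tile `gwK` with `w ∈ A ^ n` once `1 ∈
A`. If `A` lies in the word ball of radius `b`, at most `N` plaques occur for each `w` in the ball
of radius `bn`, which is the estimate.

Finite generation is the classical argument: `G` acts freely and properly discontinuously on the
connected space `X`, so the finitely many elements that do not move `interior K` off itself generate
`G`. -/

section Topology

/-- In a connected set, a set `W` that is "locally constant" and is met is everything. -/
theorem IsPreconnected.forall_mem_of_eventually {α : Type*} [TopologicalSpace α] {s : Set α}
    (hs : IsPreconnected s) (W : Set α) (h : ∀ x ∈ s, ∀ᶠ y in 𝓝 x, (x ∈ W ↔ y ∈ W))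
    {x y : α} (hx : x ∈ s) (hy : y ∈ s) (hxW : x ∈ W) : y ∈ W := by
  have := hs.induction₂ (fun a b => a ∈ W ↔ b ∈ W)
    (fun a ha => (h a ha).filter_mono nhdsWithin_le_nhds)
    (fun _ _ _ _ _ _ h₁ h₂ => h₁.trans h₂) (fun _ _ _ _ h => h.symm) hx hy
  exact this.1 hxW

theorem nonempty_chartedSpace {H X : Type*} [TopologicalSpace H] [TopologicalSpace X]
    (h : ∀ x : X, ∃ e : OpenPartialHomeomorph X H, x ∈ e.source) : Nonempty (ChartedSpace H X) := by
  choose e he using h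
  exact ⟨{ atlas := range e
           chartAt := e
           mem_chart_source := he
           chart_mem_atlas := fun x => mem_range_self x }⟩

end Topology

/-! ### The leaf topology and its charts -/

namespace Foliation

variable {p q : ℕ} {M : Type*} [TopologicalSpace M] {F : Foliation p q M}

theorem isOpen_leafwise_iff {W : Set F.Leafwise} : IsOpen W ↔
    ∀ x : M, F.toLeafwise x ∈ W → ∀ φ ∈ F.charts, x ∈ φ.source →
      ∀ᶠ y in 𝓝 x, (φ y).2 = (φ x).2 → F.toLeafwise y ∈ W := Iff.rfl

theorem continuous_toLeafwise_symm : Continuous (F.toLeafwise.symm : F.Leafwise → M) := by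
  refine ⟨fun W hW => isOpen_leafwise_iff.2 fun x hx φ _ _ => ?_⟩
  filter_upwards [hW.mem_nhds (show x ∈ W by simpa using hx)] with y hy _
  simpa using hy

instance [T2Space M] : T2Space F.Leafwise :=
  T2Space.of_injective_continuous F.toLeafwise.symm.injective continuous_toLeafwise_symm

section Charts

variable {φ : OpenPartialHomeomorph M (Eucl p × Eucl q)}

/-- The leaf topology is tested only on charts of the given atlas; `LeafCompatible` carries the test
over to any chart of the maximal atlas. -/
theorem IsFoliatedChart.isOpen_plaque (hφ : F.IsFoliatedChart φ) (b : Eucl q) :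
    IsOpen (F.toLeafwise.symm ⁻¹' {y | y ∈ φ.source ∧ (φ y).2 = b}) := by
  refine isOpen_leafwise_iff.2 fun x hx ψ hψ hxψ => ?_
  have hx : x ∈ φ.source ∧ (φ x).2 = b := by simpa using hx
  obtain ⟨U, hU, h⟩ := hφ ψ hψ x ⟨hx.1, hxψ⟩
  filter_upwards [hU, φ.open_source.mem_nhds hx.1] with y hyU hyφ hy
  refine (show y ∈ φ.source ∧ (φ y).2 = b from ⟨hyφ, ?_⟩)
  rw [← hx.2]
  exact (h y hyU x (mem_of_mem_nhds hU)).2 hy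

theorem IsFoliatedChart.continuousOn_plaque (hφ : F.IsFoliatedChart φ) (b : Eucl q) :
    ContinuousOn (fun a => F.toLeafwise (φ.symm (a, b))) {a | (a, b) ∈ φ.target} := by
  have hopen : IsOpen {a : Eucl p | (a, b) ∈ φ.target} :=
    φ.open_target.preimage (by fun_prop)
  intro a ha
  apply ContinuousAt.continuousWithinAt
  have ha : (a, b) ∈ φ.target := ha
  intro N hN
  obtain ⟨W, hWN, hW, haW⟩ := mem_nhds_iff.1 hN
  set x := φ.symm (a, b) with hx
  have hxφ : x ∈ φ.source := φ.map_target ha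
  obtain ⟨ψ, hψ, hxψ⟩ := F.cover x
  obtain ⟨U, hU, h⟩ := hφ ψ hψ x ⟨hxφ, hxψ⟩
  have hcont : ContinuousAt (fun a' : Eucl p => φ.symm (a', b)) a :=
    ContinuousAt.comp (f := fun a' : Eucl p => (a', b)) (φ.continuousAt_symm ha) (by fun_prop)
  have h1 := hcont.eventually (isOpen_leafwise_iff.1 hW x haW ψ hψ hxψ)
  have h2 := hcont.eventually hU
  have h3 : ∀ᶠ a' in 𝓝 a, (a', b) ∈ φ.target := hopen.mem_nhds ha
  change ∀ᶠ a' in 𝓝 a, F.toLeafwise (φ.symm (a', b)) ∈ N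
  filter_upwards [h1, h2, h3] with a' h1 h2 h3
  refine hWN (h1 ((h _ h2 _ (mem_of_mem_nhds hU)).1 ?_))
  rw [φ.right_inv h3, hx, φ.right_inv ha]

/-- The leaf coordinate of a foliated chart, as a chart of the leaf topology. -/
def IsFoliatedChart.leafChart (hφ : F.IsFoliatedChart φ) (b : Eucl q) :
    OpenPartialHomeomorph F.Leafwise (Eucl p) where
  toFun z := (φ (F.toLeafwise.symm z)).1
  invFun a := F.toLeafwise (φ.symm (a, b))
  source := F.toLeafwise.symm ⁻¹' {y | y ∈ φ.source ∧ (φ y).2 = b}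
  target := {a | (a, b) ∈ φ.target}
  map_source' z hz := by
    have h := φ.map_source hz.1
    have : φ (F.toLeafwise.symm z) = ((φ (F.toLeafwise.symm z)).1, b) := Prod.ext rfl hz.2
    rwa [this] at h
  map_target' a ha := by
    have ha : (a, b) ∈ φ.target := ha
    simp [ha, φ.right_inv ha]
  left_inv' z hz := by
    have : ((φ (F.toLeafwise.symm z)).1, b) = φ (F.toLeafwise.symm z) := Prod.ext rfl hz.2.symm
    rw [this, φ.left_inv hz.1, Equiv.apply_symm_apply]
  right_inv' a ha := by
    have ha : (a, b) ∈ φ.target := ha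
    simp [φ.right_inv ha]
  open_source := hφ.isOpen_plaque b
  open_target := φ.open_target.preimage (by fun_prop)
  continuousOn_toFun := by
    refine continuous_fst.comp_continuousOn (φ.continuousOn.comp
      continuous_toLeafwise_symm.continuousOn fun z hz => hz.1)
  continuousOn_invFun := hφ.continuousOn_plaque b

theorem IsFoliatedChart.eventually_leafwise (hφ : F.IsFoliatedChart φ) {z : F.Leafwise}
    (hz : F.toLeafwise.symm z ∈ φ.source) :
    ∀ᶠ w in 𝓝 z, F.toLeafwise.symm w ∈ φ.source ∧
      (φ (F.toLeafwise.symm w)).2 = (φ (F.toLeafwise.symm z)).2 :=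
  (hφ.isOpen_plaque _).mem_nhds ⟨hz, rfl⟩

/-- The transverse coordinate is constant on leafwise connected sets in the domain. -/
theorem IsFoliatedChart.snd_eq_of_isPreconnected (hφ : F.IsFoliatedChart φ) {s : Set F.Leafwise}
    (hs : IsPreconnected s) (hsφ : ∀ z ∈ s, F.toLeafwise.symm z ∈ φ.source) {z w : F.Leafwise}
    (hz : z ∈ s) (hw : w ∈ s) :
    (φ (F.toLeafwise.symm w)).2 = (φ (F.toLeafwise.symm z)).2 := by
  refine hs.forall_mem_of_eventually
    {w | (φ (F.toLeafwise.symm w)).2 = (φ (F.toLeafwise.symm z)).2} (fun y hy => ?_) hz hw rfl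
  filter_upwards [hφ.eventually_leafwise (hsφ y hy)] with y' hy'
  simp [hy'.2]

end Charts

theorem exists_isFoliatedChart (F : Foliation p q M) (x : M) :
    ∃ φ, F.IsFoliatedChart φ ∧ x ∈ φ.source := by
  obtain ⟨φ, hφ, hx⟩ := F.cover x
  exact ⟨φ, F.compatible φ hφ, hx⟩

theorem exists_leafChart (F : Foliation p q M) (z : F.Leafwise) :
    ∃ e : OpenPartialHomeomorph F.Leafwise (Eucl p), z ∈ e.source := by
  obtain ⟨φ, hφ, hx⟩ := F.exists_isFoliatedChart (F.toLeafwise.symm z)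
  exact ⟨hφ.leafChart _, hx, rfl⟩

/-- Charts of the leaf topology pull back to `X`. This is the source of local connectedness and
local compactness of `X`, which is otherwise an arbitrary space. -/
theorem exists_chart_of_isLocalHomeomorph {X : Type*} [TopologicalSpace X] {f : X → F.Leafwise}
    (hf : IsLocalHomeomorph f) (x : X) :
    ∃ e : OpenPartialHomeomorph X (Eucl p), x ∈ e.source := by
  obtain ⟨e, hx, rfl⟩ := hf x
  obtain ⟨e', hx'⟩ := F.exists_leafChart (e x)
  exact ⟨e.trans e', by simp [hx, hx']⟩

theorem locallyConnectedSpace_of_isLocalHomeomorph {X : Type*} [TopologicalSpace X]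
    {f : X → F.Leafwise} (hf : IsLocalHomeomorph f) : LocallyConnectedSpace X := by
  obtain ⟨_⟩ := nonempty_chartedSpace (exists_chart_of_isLocalHomeomorph hf)
  exact ChartedSpace.locallyConnectedSpace (Eucl p) X

theorem locallyCompactSpace_of_isLocalHomeomorph {X : Type*} [TopologicalSpace X]
    {f : X → F.Leafwise} (hf : IsLocalHomeomorph f) : LocallyCompactSpace X := by
  obtain ⟨_⟩ := nonempty_chartedSpace (exists_chart_of_isLocalHomeomorph hf)
  exact ChartedSpace.locallyCompactSpace (Eucl p) X

end Foliation

/-! ### Deck transformations and finite generation -/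

/-- If the translates of an open set `U` cover a connected space, then the group is generated by the
elements that do not move `U` off itself. -/
theorem Subgroup.closure_setOf_image_meets_eq_top {G X : Type*} [Group G] [TopologicalSpace X]
    [PreconnectedSpace X] (ρ : G →* (X ≃ₜ X)) {U : Set X} (hU : IsOpen U) (hne : U.Nonempty)
    (hcov : ∀ x, ∃ g, ∃ u ∈ U, ρ g u = x) :
    Subgroup.closure {g | ∃ u ∈ U, ρ g u ∈ U} = ⊤ := by
  set Γ := Subgroup.closure {g | ∃ u ∈ U, ρ g u ∈ U} with hΓ
  -- Translates of `U` by elements inside and outside `Γ` are disjoint, so the union of the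
  -- `Γ`-translates is open with open complement.
  have key : ∀ g h : G, ∀ u ∈ U, ∀ v ∈ U, ρ g u = ρ h v → (g ∈ Γ ↔ h ∈ Γ) := by
    intro g h u hu v hv huv
    have hgh : h⁻¹ * g ∈ Γ := by
      refine Subgroup.subset_closure ⟨u, hu, ?_⟩
      rw [map_mul, map_inv, Homeomorph.mul_apply, huv, ← Homeomorph.mul_apply, inv_mul_cancel]
      exact hv
    constructor
    · intro hg
      have := Γ.mul_mem hg (Γ.inv_mem hgh)
      simpa using this
    · intro hh
      have := Γ.mul_mem hh hgh
      simpa using this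
  obtain ⟨u₀, hu₀⟩ := hne
  rw [eq_top_iff]
  intro g _
  have := isPreconnected_univ.forall_mem_of_eventually {x : X | ∃ h ∈ Γ, ∃ u ∈ U, ρ h u = x}
    (fun x _ => ?_) (mem_univ u₀) (mem_univ (ρ g u₀)) ⟨1, Γ.one_mem, u₀, hu₀, by simp⟩
  · obtain ⟨h, hh, u, hu, he⟩ := this
    exact (key h g u hu u₀ hu₀ he).1 hh
  · obtain ⟨k, u, hu, rfl⟩ := hcov x
    filter_upwards [((ρ k).isOpenMap U hU).mem_nhds (mem_image_of_mem _ hu)] with y hy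
    obtain ⟨v, hv, rfl⟩ := hy
    constructor
    · rintro ⟨h, hh, w, hw, he⟩
      exact ⟨k, (key h k w hw u hu he).1 hh, v, hv, rfl⟩
    · rintro ⟨h, hh, w, hw, he⟩
      exact ⟨k, (key h k w hw v hv he).1 hh, u, hu, rfl⟩

namespace Foliation.HaefligerSuspension

variable {p q : ℕ} {M : Type*} [TopologicalSpace M] {F : Foliation p q M} {x₀ : M} {T : Set M}
  {X : Type*} [TopologicalSpace X] (H : F.HaefligerSuspension x₀ T X)


theorem locallyConnectedSpace (H : F.HaefligerSuspension x₀ T X) (t : T) :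
    LocallyConnectedSpace X :=
  locallyConnectedSpace_of_isLocalHomeomorph (H.slice_isLocalHomeomorph t)

/-- Trades a translate in `X` for a change of the parameter in `T`. Estimates on `K × T` thereby
apply to all translates of `K`. -/
theorem toM_deck (g) (x : X) (t : T) : H.toM (H.deck g x, t) = H.toM (x, H.hol g⁻¹ t) := by
  refine ((H.toM_eq_iff _ _ _ _).2 ⟨g, rfl, ?_⟩).symm
  rw [← Homeomorph.mul_apply, ← map_mul, mul_inv_cancel, map_one, Homeomorph.one_apply]

/-- On the slice over `x₀` the map `toM` is `cov`, so transitivity of the deck group on the fibres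
of `cov` is read off from the orbits of the diagonal action. -/
theorem exists_deck_eq (hx₀ : x₀ ∈ T) {x y : X} (h : H.cov x = H.cov y) : ∃ g, H.deck g x = y := by
  have : H.toM (x, ⟨x₀, hx₀⟩) = H.toM (y, ⟨x₀, hx₀⟩) := by
    rw [H.toM_leaf _ _ rfl, H.toM_leaf _ _ rfl, h]
  obtain ⟨g, hg, _⟩ := (H.toM_eq_iff _ _ _ _).1 this
  exact ⟨g, hg.symm⟩

theorem cov_surjective : Function.Surjective H.cov := by
  intro y
  have : PathConnectedSpace (F.Leaf x₀) :=
    isPathConnected_iff_pathConnectedSpace.1 isPathConnected_pathComponent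
  obtain ⟨γ⟩ := PathConnectedSpace.joined (F.basePoint x₀) y
  have h0 : γ.toContinuousMap 0 = H.cov H.base := by simp [H.cov_base]
  refine ⟨H.isCoveringMap.liftPath γ.toContinuousMap H.base h0 1, ?_⟩
  have := congrFun (H.isCoveringMap.liftPath_lifts γ.toContinuousMap H.base h0) 1
  simpa using this

/-- There is a compact set whose interior meets all orbits of the deck group. -/
theorem exists_isCompact_cover [CompactSpace (F.Leaf x₀)] (hx₀ : x₀ ∈ T) :
    ∃ K : Set X, IsCompact K ∧ ∀ x, ∃ g, ∃ k ∈ interior K, H.deck g k = x := by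
  have : LocallyCompactSpace X :=
    locallyCompactSpace_of_isLocalHomeomorph (H.slice_isLocalHomeomorph ⟨x₀, hx₀⟩)
  obtain ⟨K, hK, hKU⟩ : ∃ K : Set X, IsCompact K ∧ univ ⊆ H.cov '' interior K := by
    refine isCompact_univ.induction_on (p := fun s => ∃ K, IsCompact K ∧ s ⊆ H.cov '' interior K)
      ⟨∅, isCompact_empty, by simp⟩ (fun s t hst ⟨K, hK, h⟩ => ⟨K, hK, hst.trans h⟩)
      (fun s t ⟨K, hK, h⟩ ⟨K', hK', h'⟩ => ⟨K ∪ K', hK.union hK', union_subset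
        (h.trans (image_mono (interior_mono subset_union_left)))
        (h'.trans (image_mono (interior_mono subset_union_right)))⟩) (fun y _ => ?_)
    obtain ⟨x, rfl⟩ := H.cov_surjective y
    obtain ⟨K, hK, hKx⟩ := exists_compact_mem_nhds x
    exact ⟨H.cov '' interior K, mem_nhdsWithin_of_mem_nhds
      ((H.isCoveringMap.isOpenMap _ isOpen_interior).mem_nhds
        (mem_image_of_mem _ (mem_interior_iff_mem_nhds.2 hKx))), K, hK, Subset.rfl⟩
  refine ⟨K, hK, fun x => ?_⟩
  obtain ⟨k, hk, hkx⟩ := hKU (mem_univ (H.cov x))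
  obtain ⟨g, hg⟩ := H.exists_deck_eq hx₀ hkx
  exact ⟨g, k, hk, hg⟩

section SimplyConnected

variable [SimplyConnectedSpace X]

/-- A fixed point forces `deck g = id` by uniqueness of lifts. If `g = [γ]`, then `deck_lift` says
that the lift of `γ` from `base` closes up; it is null-homotopic in the simply connected `X`, hence
so is `γ` in the leaf. -/
theorem eq_one_of_deck_apply_eq {g} {x : X} (h : H.deck g x = x) : g = 1 := by
  have hid : (H.deck g : X → X) = id :=
    H.isCoveringMap.eq_of_comp_eq (H.deck g).continuous continuous_id
      (funext fun y => by simp [H.cov_deck]) x (by simp [h])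
  obtain ⟨γ, rfl⟩ : ∃ γ : Path (F.basePoint x₀) (F.basePoint x₀),
      FundamentalGroup.fromPath (Path.Homotopic.Quotient.mk γ) = g := by
    obtain ⟨γ, hγ⟩ := Quotient.exists_rep (FundamentalGroup.toPath g)
    exact ⟨γ, hγ⟩
  have h0 : γ.toContinuousMap 0 = H.cov H.base := by simp [H.cov_base]
  set c := H.isCoveringMap.liftPath γ.toContinuousMap H.base h0 with hc
  have hc0 : c 0 = H.base := H.isCoveringMap.liftPath_zero _ _ _
  have hcγ : ∀ s, H.cov (c s) = γ s :=
    congrFun (H.isCoveringMap.liftPath_lifts γ.toContinuousMap H.base h0)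
  have hc1 : c 1 = H.base := by
    have := H.deck_lift (c 1) ⟨c, hc0, rfl⟩ γ hcγ
    rwa [hid] at this
  have hnull : γ.Homotopic (Path.refl _) := by
    have h1 := (SimplyConnectedSpace.paths_homotopic (⟨c, hc0, hc1⟩ : Path H.base H.base)
      (Path.refl _)).map ⟨H.cov, H.isCoveringMap.continuous⟩
    have h2 : ((⟨c, hc0, hc1⟩ : Path H.base H.base).map H.isCoveringMap.continuous).cast
        H.cov_base.symm H.cov_base.symm = γ := by
      ext s
      simp [hcγ]
    have h3 : ((Path.refl H.base).map H.isCoveringMap.continuous).cast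
        H.cov_base.symm H.cov_base.symm = Path.refl _ := by
      ext s
      simp [H.cov_base]
    rw [← h2, ← h3]
    obtain ⟨h1⟩ := h1
    exact ⟨h1.cast rfl rfl⟩
  have : Path.Homotopic.Quotient.mk γ = Path.Homotopic.Quotient.mk (Path.refl _) :=
    Quotient.sound hnull
  rw [this]
  rfl

/-- The deck group acts properly discontinuously. -/
theorem finite_setOf_deck_mem [T2Space M] (hx₀ : x₀ ∈ T) {K : Set X} (hK : IsCompact K) :
    {g | ∃ k ∈ K, H.deck g k ∈ K}.Finite := by
  suffices h : {g | ∃ z ∈ K ×ˢ K, H.deck g z.1 = z.2}.Finite by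
    refine h.subset ?_
    rintro g ⟨k, hk, hgk⟩
    exact ⟨(k, _), ⟨hk, hgk⟩, rfl⟩
  refine (hK.prod hK).induction_on (p := fun s => {g | ∃ z ∈ s, H.deck g z.1 = z.2}.Finite)
    (by simp) (fun s t hst h => h.subset ?_) (fun s t hs ht => (hs.union ht).subset ?_) ?_
  · rintro g ⟨z, hz, hg⟩
    exact ⟨z, hst hz, hg⟩
  · rintro g ⟨z, hz | hz, hg⟩
    · exact Or.inl ⟨z, hz, hg⟩
    · exact Or.inr ⟨z, hz, hg⟩
  · rintro ⟨x, y⟩ -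
    by_cases hxy : H.cov x = H.cov y
    -- On a product of a sheet and its `g₀`-translate, injectivity of `cov` and freeness of the
    -- action leave only `g = g₀`.
    · obtain ⟨g₀, rfl⟩ := H.exists_deck_eq hx₀ hxy
      obtain ⟨e, hxe, he⟩ := H.isCoveringMap.isLocalHomeomorph x
      refine ⟨e.source ×ˢ (H.deck g₀ '' e.source), mem_nhdsWithin_of_mem_nhds
        (prod_mem_nhds (e.open_source.mem_nhds hxe)
          (((H.deck g₀).isOpenMap _ e.open_source).mem_nhds (mem_image_of_mem _ hxe))),
        (finite_singleton g₀).subset ?_⟩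
      rintro g ⟨⟨u, _⟩, ⟨hu, v, hv, rfl⟩, hg⟩
      simp only at hg hu
      have huv : u = v := by
        refine e.injOn hu hv ?_
        rw [← he, ← H.cov_deck g u, hg, H.cov_deck]
      subst huv
      have : g₀⁻¹ * g = 1 := by
        refine H.eq_one_of_deck_apply_eq (x := u) ?_
        rw [map_mul, map_inv, Homeomorph.mul_apply, hg, ← Homeomorph.mul_apply, inv_mul_cancel]
        rfl
      exact (inv_mul_eq_one.1 this).symm
    · obtain ⟨U, V, hU, hV, hxU, hyV, hUV⟩ := t2_separation hxy
      refine ⟨(H.cov ⁻¹' U) ×ˢ (H.cov ⁻¹' V), mem_nhdsWithin_of_mem_nhds (prod_mem_nhds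
        ((hU.preimage H.isCoveringMap.continuous).mem_nhds hxU)
        ((hV.preimage H.isCoveringMap.continuous).mem_nhds hyV)), finite_empty.subset ?_⟩
      rintro g ⟨⟨u, v⟩, ⟨hu, hv⟩, hg⟩
      simp only at hg hu hv
      subst hg
      rw [mem_preimage, H.cov_deck] at hv
      exact hUV.le_bot ⟨hu, hv⟩

theorem fundamentalGroup_fg (H : F.HaefligerSuspension x₀ T X) [T2Space M]
    [CompactSpace (F.Leaf x₀)] (hx₀ : x₀ ∈ T) :
    Group.FG (FundamentalGroup (F.Leaf x₀) (F.basePoint x₀)) := by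
  obtain ⟨K, hK, hcov⟩ := H.exists_isCompact_cover hx₀
  obtain ⟨_, k, hk, _⟩ := hcov H.base
  refine Group.fg_iff.2 ⟨_, Subgroup.closure_setOf_image_meets_eq_top H.deck isOpen_interior ⟨k, hk⟩
    hcov, (H.finite_setOf_deck_mem hx₀ hK).subset ?_⟩
  rintro g ⟨u, hu, hgu⟩
  exact ⟨u, interior_subset hu, interior_subset hgu⟩

end SimplyConnected

end Foliation.HaefligerSuspension

/-! ### Uniform local structure of the suspension -/

namespace Foliation.HaefligerSuspension

variable {p q : ℕ} {M : Type*} [TopologicalSpace M] {F : Foliation p q M} {x₀ : M} {T : Set M}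
  {X : Type*} [TopologicalSpace X] (H : F.HaefligerSuspension x₀ T X)
  {φ : OpenPartialHomeomorph M (Eucl p × Eucl q)}

/-- Each point of `X × T` has a product neighbourhood whose slices lie in single plaques. -/
theorem exists_box (hφ : F.IsFoliatedChart φ) {k : X} {s : T} (hks : H.toM (k, s) ∈ φ.source)
    {D : Set X} (hD : D ∈ 𝓝 k) :
    ∃ V ⊆ D, IsOpen V ∧ k ∈ V ∧ ∃ W, IsOpen W ∧ s ∈ W ∧ ∀ w ∈ W, ∀ u ∈ V,
      H.toM (u, w) ∈ φ.source ∧ ∀ v ∈ V, (φ (H.toM (v, w))).2 = (φ (H.toM (u, w))).2 := by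
  have := H.locallyConnectedSpace s
  have hN := (φ.open_source.preimage H.continuous_toM).mem_nhds hks
  obtain ⟨V₀, hV₀, W₀, hW₀, hVW⟩ := mem_nhds_prod_iff.1 hN
  obtain ⟨V, hV, hVo, hkV, hVc⟩ := locallyConnectedSpace_iff_subsets_isOpen_isConnected.1 this k
    (D ∩ V₀) (inter_mem hD hV₀)
  refine ⟨V, hV.trans inter_subset_left, hVo, hkV, interior W₀, isOpen_interior,
    mem_interior_iff_mem_nhds.2 hW₀, fun w hw u hu => ?_⟩
  have hsrc : ∀ v ∈ V, H.toM (v, w) ∈ φ.source := fun v hv =>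
    hVW (mk_mem_prod (hV hv).2 (interior_subset hw))
  refine ⟨hsrc u hu, fun v hv => ?_⟩
  -- The transverse coordinate is constant on `V × {w}` because `V` is connected and its image is
  -- connected in the leaf topology.
  have hc : IsPreconnected ((fun x => F.toLeafwise (H.toM (x, w))) '' V) :=
    hVc.isPreconnected.image _ (H.slice_isLocalHomeomorph w).continuous.continuousOn
  have := hφ.snd_eq_of_isPreconnected hc (by rintro _ ⟨x, hx, rfl⟩; simpa using hsrc x hx)
    (mem_image_of_mem _ hu) (mem_image_of_mem _ hv)
  simpa using this

theorem map_nhds_leafCoord (hφ : F.IsFoliatedChart φ) {u : X} {w : T}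
    (h : H.toM (u, w) ∈ φ.source) :
    map (fun x => (φ (H.toM (x, w))).1) (𝓝 u) = 𝓝 (φ (H.toM (u, w))).1 := by
  have h1 := (H.slice_isLocalHomeomorph w).map_nhds_eq u
  have h2 := (hφ.leafChart (φ (H.toM (u, w))).2).map_nhds_eq
    (x := F.toLeafwise (H.toM (u, w))) ⟨by simpa using h, by simp⟩
  rw [← h1, map_map] at h2
  exact h2

/-- The slices `X × {t}` are mapped openly to the leaves, uniformly in `t`. -/
theorem exists_uniform_open (hφ : F.IsFoliatedChart φ) {k : X} {s : T}
    (hks : H.toM (k, s) ∈ φ.source) {D₀ : Set X} (hD₀ : D₀ ∈ 𝓝 k) :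
    ∃ N ∈ 𝓝 (k, s), ∃ O ∈ 𝓝 (φ (H.toM (k, s))).1, ∀ z ∈ N, ∀ a ∈ O, ∃ d ∈ D₀,
      H.toM (d, z.2) ∈ φ.source ∧ φ (H.toM (d, z.2)) = (a, (φ (H.toM z)).2) := by
  have : LocallyCompactSpace X :=
    locallyCompactSpace_of_isLocalHomeomorph (H.slice_isLocalHomeomorph s)
  obtain ⟨e, hke, he⟩ := H.slice_isLocalHomeomorph s k
  obtain ⟨V, hVD, hVo, hkV, W, hWo, hsW, hVW⟩ := H.exists_box hφ hks
    (inter_mem hD₀ (e.open_source.mem_nhds hke))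
  obtain ⟨D, hDk, hDV, hDc⟩ := local_compact_nhds (hVo.mem_nhds hkV)
  set f : X × T → Eucl p := fun z => (φ (H.toM z)).1 with hf
  have hfc : ContinuousOn f (V ×ˢ W) := continuous_fst.comp_continuousOn
    (φ.continuousOn.comp H.continuous_toM.continuousOn fun z hz => (hVW z.2 hz.2 z.1 hz.1).1)
  have hinj : InjOn (fun x => f (x, s)) V := by
    intro u hu v hv huv
    have h1 := hVW s hsW u hu
    have h2 := hVW s hsW v hv
    have h3 : φ (H.toM (u, s)) = φ (H.toM (v, s)) := Prod.ext huv (h2.2 u hu)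
    refine e.injOn (hVD hu).2 (hVD hv).2 ?_
    rw [← he]
    exact congrArg F.toLeafwise (φ.injOn h1.1 h2.1 h3)
  -- The slice map is known to be injective on `V` only for the parameter `s`. What persists for
  -- nearby `w` is that the image of `B` avoids a fixed ball around `f (k, s)`, by the tube lemma.
  set B := D \ interior D with hB
  have hBc : IsCompact B := hDc.diff isOpen_interior
  have hBV : B ⊆ V := sdiff_subset.trans hDV
  have hfw : ∀ w ∈ W, ContinuousOn (fun x => f (x, w)) V := fun w hw =>
    hfc.comp (by fun_prop) fun x hx => ⟨hx, hw⟩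
  have hnot : f (k, s) ∉ (fun x => f (x, s)) '' B := by
    rintro ⟨x, hx, hxk⟩
    have : x = k := hinj (hBV hx) hkV hxk
    exact hx.2 (this ▸ mem_interior_iff_mem_nhds.2 hDk)
  have hcl : IsClosed ((fun x => f (x, s)) '' B) :=
    (hBc.image_of_continuousOn ((hfw s hsW).mono hBV)).isClosed
  obtain ⟨ε, hε, hεB⟩ := Metric.nhds_basis_closedBall.mem_iff.1 (hcl.isOpen_compl.mem_nhds hnot)
  set O := Metric.ball (f (k, s)) ε with hO
  have hopen : IsOpen ((V ×ˢ W) ∩ f ⁻¹' (Metric.closedBall (f (k, s)) ε)ᶜ) :=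
    hfc.isOpen_inter_preimage (hVo.prod hWo) Metric.isClosed_closedBall.isOpen_compl
  obtain ⟨_, W₁, -, hW₁o, hBu, hsW₁, hW₁⟩ := generalized_tube_lemma hBc (isCompact_singleton (x := s))
    hopen (by
      rintro ⟨x, w⟩ ⟨hx, hw⟩
      obtain rfl : w = s := hw
      exact ⟨⟨hBV hx, hsW⟩, fun h => hεB h (mem_image_of_mem _ hx)⟩)
  have hW₂ : ∀ᶠ w in 𝓝 s, f (k, w) ∈ O := by
    have : ContinuousAt (fun w => f (k, w)) s :=
      ContinuousAt.comp (f := fun w : T => (k, w)) (hfc.continuousAt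
        ((hVo.prod hWo).mem_nhds ⟨hkV, hsW⟩)) (by fun_prop)
    exact this (Metric.ball_mem_nhds _ hε)
  refine ⟨V ×ˢ (W ∩ W₁ ∩ {w | f (k, w) ∈ O}), prod_mem_nhds (hVo.mem_nhds hkV) (inter_mem (inter_mem
    (hWo.mem_nhds hsW) (hW₁o.mem_nhds (hsW₁ rfl))) hW₂), O, Metric.ball_mem_nhds _ hε, ?_⟩
  rintro ⟨u, w⟩ ⟨hu, ⟨hwW, hwW₁⟩, hwk⟩ a ha
  simp only at hu hwW hwW₁ hwk ⊢
  suffices h : a ∈ (fun x => f (x, w)) '' D by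
    obtain ⟨d, hd, rfl⟩ := h
    have hdV := hDV hd
    have := hVW w hwW u hu
    exact ⟨d, (hVD hdV).1, (hVW w hwW d hdV).1, Prod.ext rfl (this.2 d hdV)⟩
  have hDcl : IsClosed ((fun x => f (x, w)) '' D) :=
    (hDc.image_of_continuousOn ((hfw w hwW).mono hDV)).isClosed
  -- Within the ball, the image of `D` is closed by compactness and open because only interior
  -- points of `D` map there. It contains `f (k, w)`, so by connectedness it fills the ball.
  refine (convex_ball (f (k, s)) ε).isPreconnected.forall_mem_of_eventually _ (fun y hy => ?_) hwk ha
    (mem_image_of_mem _ (mem_of_mem_nhds hDk))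
  by_cases hyD : y ∈ (fun x => f (x, w)) '' D
  · simp only [hyD, true_iff]
    obtain ⟨d, hd, rfl⟩ := hyD
    have hdi : d ∈ interior D := by
      by_contra hdi
      exact (hW₁ ⟨hBu ⟨hd, hdi⟩, hwW₁⟩).2 (Metric.ball_subset_closedBall hy)
    have hmap := H.map_nhds_leafCoord hφ (hVW w hwW d (hDV hd)).1
    have : (fun x => f (x, w)) '' D ∈ map (fun x => f (x, w)) (𝓝 d) :=
      image_mem_map (mem_interior_iff_mem_nhds.1 hdi)
    rwa [hmap] at this
  · simp only [hyD, false_iff]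
    exact hDcl.isOpen_compl.mem_nhds hyD

end Foliation.HaefligerSuspension

/-! ### Transport of translates of `K` along leaves -/

namespace Foliation.HaefligerSuspension

variable {p q : ℕ} {M : Type*} [TopologicalSpace M] {F : Foliation p q M} {x₀ : M} {T : Set M}
  {X : Type*} [TopologicalSpace X] (H : F.HaefligerSuspension x₀ T X)
  {φ : OpenPartialHomeomorph M (Eucl p × Eucl q)}

/-- In every slice `X × {s}`, if `y` has a preimage in `K`, then `y'` has a preimage in one of the
translates of `K` by elements of `A`. -/
def Transport (K : Set X) (A : Set (FundamentalGroup (F.Leaf x₀) (F.basePoint x₀))) (y y' : M) :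
    Prop :=
  ∀ k ∈ K, ∀ s : T, H.toM (k, s) = y → ∃ h ∈ A, ∃ k' ∈ K, H.toM (H.deck h k', s) = y'

variable {H} {K : Set X} {A B : Set (FundamentalGroup (F.Leaf x₀) (F.basePoint x₀))} {y y' y'' : M}

theorem Transport.mono (h : H.Transport K A y y') (hAB : A ⊆ B) : H.Transport K B y y' :=
  fun k hk s hks => by
    obtain ⟨g, hg, k', hk', e⟩ := h k hk s hks
    exact ⟨g, hAB hg, k', hk', e⟩

/-- A translated form of `Transport`. -/
theorem Transport.apply_deck (h : H.Transport K A y y')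
    (g : FundamentalGroup (F.Leaf x₀) (F.basePoint x₀)) {k : X} (hk : k ∈ K) {s : T}
    (hy : H.toM (H.deck g k, s) = y) : ∃ a ∈ A, ∃ k' ∈ K, H.toM (H.deck (g * a) k', s) = y' := by
  -- `Transport` is uniform in the parameter, so it applies with `hol g⁻¹ s` in place of `s`; moving
  -- back puts the new element on the right of `g`.
  rw [H.toM_deck] at hy
  obtain ⟨a, ha, k', hk', e⟩ := h k hk _ hy
  refine ⟨a, ha, k', hk', ?_⟩
  rw [map_mul, Homeomorph.mul_apply, H.toM_deck, e]

theorem Transport.trans (h : H.Transport K A y y') (h' : H.Transport K B y' y'') :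
    H.Transport K (A * B) y y'' := fun k hk s hks => by
  obtain ⟨a, ha, k', hk', e⟩ := h k hk s hks
  obtain ⟨b, hb, k'', hk'', e'⟩ := h'.apply_deck a hk' e
  exact ⟨a * b, mul_mem_mul ha hb, k'', hk'', e'⟩

variable [T2Space M]

/-- Transport between nearby points of the same local leaf. -/
theorem exists_transport_nhds (hT : IsCompact T) (hK : IsCompact K)
    (hcov : ∀ x, ∃ g, ∃ k ∈ interior K, H.deck g k = x) (hφ : F.IsFoliatedChart φ)
    (hy : y ∈ φ.source) :
    ∃ O ∈ 𝓝 y, ∃ A : Set (FundamentalGroup (F.Leaf x₀) (F.basePoint x₀)), A.Finite ∧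
      ∀ y' ∈ O, ∀ y'' ∈ O, (φ y').2 = (φ y'').2 → H.Transport K A y' y'' := by
  have : CompactSpace T := isCompact_iff_compactSpace.1 hT
  suffices h : ∃ O ∈ 𝓝 y, ∃ A : Set (FundamentalGroup (F.Leaf x₀) (F.basePoint x₀)), A.Finite ∧
      ∀ y' ∈ O, ∀ y'' ∈ O, (φ y').2 = (φ y'').2 → ∀ z ∈ K ×ˢ (univ : Set T), H.toM z = y' →
        ∃ h ∈ A, ∃ k' ∈ K, H.toM (H.deck h k', z.2) = y'' by
    obtain ⟨O, hO, A, hA, h⟩ := h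
    exact ⟨O, hO, A, hA, fun y' hy' y'' hy'' e k hk s hks =>
      h y' hy' y'' hy'' e (k, s) ⟨hk, mem_univ _⟩ hks⟩
  refine (hK.prod isCompact_univ).induction_on (p := fun Z => ∃ O ∈ 𝓝 y,
    ∃ A : Set (FundamentalGroup (F.Leaf x₀) (F.basePoint x₀)), A.Finite ∧
      ∀ y' ∈ O, ∀ y'' ∈ O, (φ y').2 = (φ y'').2 → ∀ z ∈ Z, H.toM z = y' →
        ∃ h ∈ A, ∃ k' ∈ K, H.toM (H.deck h k', z.2) = y'') ?_ ?_ ?_ ?_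
  · exact ⟨univ, univ_mem, ∅, finite_empty, by simp⟩
  · rintro Z Z' hZ ⟨O, hO, A, hA, h⟩
    exact ⟨O, hO, A, hA, fun y' hy' y'' hy'' e z hz => h y' hy' y'' hy'' e z (hZ hz)⟩
  · rintro Z Z' ⟨O, hO, A, hA, h⟩ ⟨O', hO', A', hA', h'⟩
    refine ⟨O ∩ O', inter_mem hO hO', A ∪ A', hA.union hA', fun y' hy' y'' hy'' e z hz hzy => ?_⟩
    rcases hz with hz | hz
    · obtain ⟨g, hg, r⟩ := h y' hy'.1 y'' hy''.1 e z hz hzy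
      exact ⟨g, Or.inl hg, r⟩
    · obtain ⟨g, hg, r⟩ := h' y' hy'.2 y'' hy''.2 e z hz hzy
      exact ⟨g, Or.inr hg, r⟩
  · rintro ⟨k, s⟩ -
    by_cases hks : H.toM (k, s) = y
    · subst hks
      -- `k` may lie on the boundary of `K`, but it is interior to some translate `gK`. That
      -- translate receives the nearby preimages, so `A = {g}` suffices near `(k, s)`.
      obtain ⟨g, k', hk', rfl⟩ := hcov k
      have hD : H.deck g '' K ∈ 𝓝 (H.deck g k') :=
        mem_of_superset (((H.deck g).isOpenMap _ isOpen_interior).mem_nhds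
          (mem_image_of_mem _ hk')) (image_mono interior_subset)
      obtain ⟨N, hN, O, hO, h⟩ := H.exists_uniform_open hφ hy hD
      refine ⟨N, mem_nhdsWithin_of_mem_nhds hN, φ.source ∩ (fun y => (φ y).1) ⁻¹' O,
        inter_mem (φ.open_source.mem_nhds hy)
          (ContinuousAt.preimage_mem_nhds (continuous_fst.continuousAt.comp
            (φ.continuousAt hy)) hO), {g}, finite_singleton g, ?_⟩
      rintro y' - y'' ⟨hy'', hO''⟩ e z hz rfl
      obtain ⟨_, ⟨d, hd, rfl⟩, hsrc, hd'⟩ := h z hz _ hO''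
      exact ⟨g, rfl, d, hd, φ.injOn hsrc hy'' (by rw [hd', e])⟩
    · obtain ⟨U, V, hU, hV, hxU, hyV, hUV⟩ := t2_separation hks
      refine ⟨H.toM ⁻¹' U, mem_nhdsWithin_of_mem_nhds
        ((hU.preimage H.continuous_toM).mem_nhds hxU), V, hV.mem_nhds hyV, ∅, finite_empty, ?_⟩
      rintro y' hy' y'' hy'' e z hz rfl
      exact (hUV.le_bot ⟨hz, hy'⟩).elim

/-- The image of a slice contains each leaf that it meets. -/
theorem leaf_subset_range (H : F.HaefligerSuspension x₀ T X)
    (hT : IsCompact T) (hK : IsCompact K)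
    (hcov : ∀ x, ∃ g, ∃ k ∈ interior K, H.deck g k = x) (u : X) (t : T) :
    F.leaf (H.toM (u, t)) ⊆ range fun x => H.toM (x, t) := by
  intro y hy
  have hpre := (isPathConnected_pathComponent
    (x := F.toLeafwise (H.toM (u, t)))).isConnected.isPreconnected
  -- By local transport, membership in the image of the slice is locally constant for the leaf
  -- topology, and the leaf is connected.
  refine hpre.forall_mem_of_eventually (F.toLeafwise.symm ⁻¹' range fun x => H.toM (x, t))
    (fun z _ => ?_) (mem_pathComponent_self _) (y := F.toLeafwise y) hy ⟨u, by simp⟩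
  obtain ⟨φ, hφ, hz⟩ := F.exists_isFoliatedChart (F.toLeafwise.symm z)
  obtain ⟨O, hO, A, -, h⟩ := exists_transport_nhds (H := H) hT hK hcov hφ hz
  have key : ∀ y' ∈ O, ∀ y'' ∈ O, (φ y').2 = (φ y'').2 → y' ∈ (range fun x => H.toM (x, t)) →
      y'' ∈ range fun x => H.toM (x, t) := by
    rintro y' hy' y'' hy'' e ⟨x, hx⟩
    obtain ⟨g, k, hk, rfl⟩ := hcov x
    obtain ⟨a, -, k', -, e⟩ := (h y' hy' y'' hy'' e).apply_deck g (interior_subset hk) hx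
    exact ⟨_, e⟩
  filter_upwards [hφ.eventually_leafwise hz,
    continuous_toLeafwise_symm.continuousAt.preimage_mem_nhds hO] with w hw hwO
  exact ⟨key _ (mem_of_mem_nhds hO) _ hwO hw.2.symm, key _ hwO _ (mem_of_mem_nhds hO) hw.2⟩

/-- Transport along plaques, uniformly over a compact box of a foliated chart. -/
theorem exists_transport_box (hT : IsCompact T) (hK : IsCompact K)
    (hcov : ∀ x, ∃ g, ∃ k ∈ interior K, H.deck g k = x) (hφ : F.IsFoliatedChart φ)
    {C : Set (Eucl p)} {D : Set (Eucl q)} (hC : IsCompact C) (hC' : IsPreconnected C)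
    (hD : IsCompact D) (hCD : C ×ˢ D ⊆ φ.target) :
    ∃ A : Set (FundamentalGroup (F.Leaf x₀) (F.basePoint x₀)), A.Finite ∧
      ∀ b ∈ D, ∀ a ∈ C, ∀ a' ∈ C, H.Transport K A (φ.symm (a, b)) (φ.symm (a', b)) := by
  rcases C.eq_empty_or_nonempty with rfl | ⟨a₀, ha₀⟩
  · exact ⟨∅, finite_empty, by simp⟩
  refine hD.induction_on (p := fun D => ∃ A : Set (FundamentalGroup (F.Leaf x₀) (F.basePoint x₀)),
    A.Finite ∧ ∀ b ∈ D, ∀ a ∈ C, ∀ a' ∈ C, H.Transport K A (φ.symm (a, b)) (φ.symm (a', b)))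
    ⟨∅, finite_empty, by simp⟩ (fun s t hst ⟨A, hA, h⟩ => ⟨A, hA, fun b hb => h b (hst hb)⟩)
    (fun s t ⟨A, hA, h⟩ ⟨A', hA', h'⟩ => ⟨A ∪ A', hA.union hA', fun b hb a ha a' ha' => ?_⟩)
    (fun b hb => ?_)
  · rcases hb with hb | hb
    · exact (h b hb a ha a' ha').mono subset_union_left
    · exact (h' b hb a ha a' ha').mono subset_union_right
  have hloc : ∀ a ∈ C, ∃ O ∈ 𝓝 a, ∃ W ∈ 𝓝 b,
      ∃ A : Set (FundamentalGroup (F.Leaf x₀) (F.basePoint x₀)), A.Finite ∧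
      ∀ b' ∈ W, ∀ a₁ ∈ O, ∀ a₂ ∈ O, H.Transport K A (φ.symm (a₁, b')) (φ.symm (a₂, b')) := by
    intro a ha
    have hab := hCD (mk_mem_prod ha hb)
    obtain ⟨N, hN, A, hA, h⟩ := exists_transport_nhds (H := H) hT hK hcov hφ (φ.map_target hab)
    have hN' := inter_mem (φ.open_target.mem_nhds hab)
      ((φ.continuousAt_symm hab).preimage_mem_nhds hN)
    obtain ⟨O, hO, W, hW, hOW⟩ := mem_nhds_prod_iff.1 hN'
    refine ⟨O, hO, W, hW, A, hA, fun b' hb' a₁ h₁ a₂ h₂ => ?_⟩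
    have h₁ := hOW (mk_mem_prod h₁ hb')
    have h₂ := hOW (mk_mem_prod h₂ hb')
    exact h _ h₁.2 _ h₂.2 (by rw [φ.right_inv h₁.1, φ.right_inv h₂.1])
  -- Transport in both directions between `s` and `a'`, with one finite set valid for all `b'` near
  -- `b`. Connectedness of `C` relates each point to `a₀`; compactness of `C` then makes the finite
  -- set uniform.
  set R : Set (Eucl p) → Eucl p → Prop := fun s a' => ∃ W ∈ 𝓝 b,
      ∃ A : Set (FundamentalGroup (F.Leaf x₀) (F.basePoint x₀)), A.Finite ∧
      ∀ b' ∈ W, ∀ a ∈ s, H.Transport K A (φ.symm (a, b')) (φ.symm (a', b')) ∧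
        H.Transport K A (φ.symm (a', b')) (φ.symm (a, b')) with hR
  have hRtrans : ∀ s a a', R s a → R {a} a' → R s a' := by
    rintro s a a' ⟨W, hW, A, hA, h⟩ ⟨W', hW', A', hA', h'⟩
    refine ⟨W ∩ W', inter_mem hW hW', (A * A') ∪ (A' * A), (hA.mul hA').union (hA'.mul hA),
      fun b' hb' c hc => ?_⟩
    have h₁ := h b' hb'.1 c hc
    have h₂ := h' b' hb'.2 a rfl
    exact ⟨(h₁.1.trans h₂.1).mono subset_union_left, (h₂.2.trans h₁.2).mono subset_union_right⟩
  have hRlocal : ∀ a ∈ C, ∃ O ∈ 𝓝 a, R O a := by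
    intro a ha
    obtain ⟨O, hO, W, hW, A, hA, h⟩ := hloc a ha
    exact ⟨O, hO, W, hW, A, hA, fun b' hb' c hc =>
      ⟨h b' hb' c hc a (mem_of_mem_nhds hO), h b' hb' a (mem_of_mem_nhds hO) c hc⟩⟩
  have hRsub : ∀ s t a, s ⊆ t → R t a → R s a := by
    rintro s t a hst ⟨W, hW, A, hA, h⟩
    exact ⟨W, hW, A, hA, fun b' hb' c hc => h b' hb' c (hst hc)⟩
  have hRsymm : ∀ a a', R {a} a' → R {a'} a := by
    rintro a a' ⟨W, hW, A, hA, h⟩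
    exact ⟨W, hW, A, hA, fun b' hb' c hc => by rw [mem_singleton_iff.1 hc]; exact (h b' hb' a rfl).symm⟩
  have hRall : ∀ a ∈ C, R {a} a₀ := fun a ha =>
    hC'.induction₂ (fun a a' => R {a} a') (fun a ha => by
      obtain ⟨O, hO, h⟩ := hRlocal a ha
      filter_upwards [mem_nhdsWithin_of_mem_nhds hO] with c hc
      exact hRsymm _ _ (hRsub _ _ _ (singleton_subset_iff.2 hc) h))
      (fun a a' a'' _ _ _ h h' => hRtrans _ _ _ h h') (fun a a' _ _ => hRsymm a a') ha ha₀
  have hRC : R C a₀ := by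
    refine hC.induction_on (p := fun s => R s a₀) ⟨univ, univ_mem, ∅, finite_empty, by simp⟩
      (fun s t hst => hRsub s t a₀ hst) ?_ (fun a ha => ?_)
    · rintro s t ⟨W, hW, A, hA, h⟩ ⟨W', hW', A', hA', h'⟩
      refine ⟨W ∩ W', inter_mem hW hW', A ∪ A', hA.union hA', fun b' hb' c hc => ?_⟩
      rcases hc with hc | hc
      · exact ⟨(h b' hb'.1 c hc).1.mono subset_union_left, (h b' hb'.1 c hc).2.mono subset_union_left⟩
      · exact ⟨(h' b' hb'.2 c hc).1.mono subset_union_right,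
          (h' b' hb'.2 c hc).2.mono subset_union_right⟩
    · obtain ⟨O, hO, h⟩ := hRlocal a ha
      exact ⟨O, mem_nhdsWithin_of_mem_nhds hO, hRtrans _ _ _ h (hRall a ha)⟩
  obtain ⟨W, hW, A, hA, h⟩ := hRC
  -- Any two points of `C` are joined through `a₀`, hence the product `A * A`.
  exact ⟨W, mem_nhdsWithin_of_mem_nhds hW, A * A, hA.mul hA, fun b' hb' a ha a' ha' =>
    (h b' hb' a ha).1.trans (h b' hb' a' ha').2⟩

end Foliation.HaefligerSuspension

/-! ### Counting and word balls -/

theorem Set.Finite.encard_biUnion_le_mul {α β : Type*} {t : Set α} (ht : t.Finite) (s : α → Set β)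
    (N : ℕ∞) (h : ∀ i ∈ t, (s i).encard ≤ N) : (⋃ i ∈ t, s i).encard ≤ N * t.encard := by
  induction t, ht using Set.Finite.induction_on with
  | empty => simp
  | @insert a t ha _ ih =>
    rw [biUnion_insert, encard_insert_of_notMem ha, mul_add, mul_one, add_comm (N * _)]
    exact (encard_union_le _ _).trans (add_le_add (h a (mem_insert _ _))
      (ih fun i hi => h i (mem_insert_of_mem _ hi)))

theorem Set.encard_iUnion_le_card {ι β : Type*} [Finite ι] {s : ι → Set β}
    (h : ∀ i, (s i).Subsingleton) : (⋃ i, s i).encard ≤ (Nat.card ι : ℕ∞) := by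
  have := finite_univ.encard_biUnion_le_mul s 1 fun i (_ : i ∈ (univ : Set ι)) =>
    encard_le_one_iff_subsingleton.2 (h i)
  simpa [encard_univ, ENat.card_eq_coe_natCard] using this

section WordGrowth

variable {G : Type*} [Group G] {S : Set G}

theorem exists_mem_insert_one_pow (hS : Subgroup.closure S = ⊤) (g : G) :
    ∃ n : ℕ, g ∈ (insert 1 (S ∪ S⁻¹) : Set G) ^ n := by
  have hg : g ∈ Subgroup.closure S := hS ▸ Subgroup.mem_top g
  have hg' : g ∈ Submonoid.closure (S ∪ S⁻¹) := by
    rwa [← Subgroup.closure_toSubmonoid]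
  induction hg' using Submonoid.closure_induction with
  | mem x hx => exact ⟨1, by simpa using Or.inr hx⟩
  | one => exact ⟨0, by simp⟩
  | mul x y _ _ hx hy =>
    obtain ⟨m, hm⟩ := hx (hS ▸ Subgroup.mem_top x)
    obtain ⟨n, hn⟩ := hy (hS ▸ Subgroup.mem_top y)
    exact ⟨m + n, pow_add (insert 1 (S ∪ S⁻¹) : Set G) m n ▸ mul_mem_mul hm hn⟩

theorem insert_one_pow_mono {m n : ℕ} (h : m ≤ n) :
    (insert 1 (S ∪ S⁻¹) : Set G) ^ m ⊆ (insert 1 (S ∪ S⁻¹) : Set G) ^ n :=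
  pow_subset_pow_right (mem_insert _ _) h

theorem exists_subset_insert_one_pow (hS : Subgroup.closure S = ⊤) {A : Set G} (hA : A.Finite) :
    ∃ n : ℕ, A ⊆ (insert 1 (S ∪ S⁻¹) : Set G) ^ n := by
  induction A, hA using Set.Finite.induction_on with
  | empty => exact ⟨0, empty_subset _⟩
  | @insert a t _ _ ih =>
    obtain ⟨m, hm⟩ := exists_mem_insert_one_pow hS a
    obtain ⟨n, hn⟩ := ih
    exact ⟨max m n, insert_subset (insert_one_pow_mono (le_max_left _ _) hm)
      (hn.trans (insert_one_pow_mono (le_max_right _ _)))⟩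

theorem finite_insert_one_pow (hS : S.Finite) (n : ℕ) :
    ((insert 1 (S ∪ S⁻¹) : Set G) ^ n).Finite := by
  induction n with
  | zero => simp
  | succ n ih =>
    rw [pow_succ]
    exact ih.mul ((hS.union hS.inv).insert 1)

end WordGrowth

/-! ### Plaques, plaque paths and tiles -/

namespace Foliation

variable {p q : ℕ} {M : Type*} [TopologicalSpace M] {F : Foliation p q M}

namespace RegularAtlas

variable {ι : Type*} (𝒰 : F.RegularAtlas ι)

/-- The plaque of `L` in `Uᵢ` through `x`. -/
def plaque (L : Set M) (i : ι) (x : M) : Set M :=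
  F.toLeafwise ⁻¹' connectedComponentIn (F.toLeafwise '' (L ∩ 𝒰.dom i)) (F.toLeafwise x)

/-- The transverse coordinate is constant on leafwise connected subsets of the chart domain.
Conversely, `A i` is open and connected, so a whole slice `A i × {b}` is path connected in the leaf
topology and stays in the leaf. -/
theorem mem_plaque_iff {z : M} {i : ι} {x y : M} (hx : x ∈ F.leaf z ∩ 𝒰.dom i) :
    y ∈ 𝒰.plaque (F.leaf z) i x ↔
      y ∈ 𝒰.dom i ∧ (𝒰.chart i y).2 = (𝒰.chart i x).2 := by
  constructor
  · intro hy
    have hsub : connectedComponentIn (F.toLeafwise '' (F.leaf z ∩ 𝒰.dom i)) (F.toLeafwise x) ⊆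
      F.toLeafwise '' (F.leaf z ∩ 𝒰.dom i) := connectedComponentIn_subset _ _
    have hdom : ∀ w ∈ connectedComponentIn (F.toLeafwise '' (F.leaf z ∩ 𝒰.dom i)) (F.toLeafwise x),
        F.toLeafwise.symm w ∈ 𝒰.dom i := fun w hw => by
      obtain ⟨v, hv, rfl⟩ := hsub hw
      simpa using hv.2
    refine ⟨hdom _ hy, ?_⟩
    exact (𝒰.foliated i).snd_eq_of_isPreconnected isPreconnected_connectedComponentIn
      (fun w hw => (hdom w hw).1) (mem_connectedComponentIn (mem_image_of_mem _ hx)) hy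
  · rintro ⟨hy, hyx⟩
    set b := (𝒰.chart i x).2 with hb
    have hbB : b ∈ 𝒰.B i := hx.2.2.2
    have htar : ∀ a ∈ 𝒰.A i, (a, b) ∈ (𝒰.chart i).target := fun a ha =>
      𝒰.closure_subset i ⟨subset_closure ha, subset_closure hbB⟩
    set s := (fun a => F.toLeafwise ((𝒰.chart i).symm (a, b))) '' 𝒰.A i with hs
    have hpath : IsPathConnected s :=
      ((𝒰.isOpen_A i).isConnected_iff_isPathConnected.1 (𝒰.isConnected_A i)).image'
        (((𝒰.foliated i).continuousOn_plaque b).mono htar)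
    have hmem : ∀ v ∈ 𝒰.dom i, (𝒰.chart i v).2 = b → F.toLeafwise v ∈ s := fun v hv hvb =>
      ⟨(𝒰.chart i v).1, hv.2.1, by
        simp only [← hvb, Prod.mk.eta, (𝒰.chart i).left_inv hv.1]⟩
    have hxs := hmem x hx.2 rfl
    refine hpath.isConnected.isPreconnected.subset_connectedComponentIn hxs ?_ (hmem y hy hyx)
    rintro _ ⟨a, ha, rfl⟩
    refine mem_image_of_mem _ ⟨?_, (𝒰.chart i).map_target (htar a ha), ?_⟩
    · have h1 : Joined (F.toLeafwise z) (F.toLeafwise x) := hx.1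
      exact h1.trans (hpath.joinedIn _ hxs _ (mem_image_of_mem _ ha)).joined
    · rw [(𝒰.chart i).right_inv (htar a ha)]
      exact ⟨ha, hbB⟩

/-- Plaques in `Uᵢ` with the same transverse coordinate are equal. -/
theorem plaque_eq_plaque {z : M} {i : ι} {x x' y y' : M} (hx : x ∈ F.leaf z ∩ 𝒰.dom i)
    (hx' : x' ∈ F.leaf z ∩ 𝒰.dom i) (hy : y ∈ 𝒰.plaque (F.leaf z) i x)
    (hy' : y' ∈ 𝒰.plaque (F.leaf z) i x') (h : (𝒰.chart i y).2 = (𝒰.chart i y').2) :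
    𝒰.plaque (F.leaf z) i x = 𝒰.plaque (F.leaf z) i x' := by
  have h₁ := ((𝒰.mem_plaque_iff hx).1 hy).2
  have h₂ := ((𝒰.mem_plaque_iff hx').1 hy').2
  ext v
  rw [𝒰.mem_plaque_iff hx, 𝒰.mem_plaque_iff hx', ← h₁, ← h₂, h]

theorem self_mem_plaque {z : M} {i : ι} {x : M} (hx : x ∈ F.leaf z ∩ 𝒰.dom i) :
    x ∈ 𝒰.plaque (F.leaf z) i x :=
  (𝒰.mem_plaque_iff hx).2 ⟨hx.2, rfl⟩

/-- The closed box is compact, so its preimage is closed in the Hausdorff space `M`. Hence points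
off the chart have neighbourhoods missing `Uᵢ`, as the local count of plaques requires. -/
theorem closure_dom_subset_source [T2Space M] (i : ι) : closure (𝒰.dom i) ⊆ (𝒰.chart i).source := by
  have hc : IsClosed ((𝒰.chart i).symm '' (closure (𝒰.A i) ×ˢ closure (𝒰.B i))) :=
    (((𝒰.isCompact_A i).prod (𝒰.isCompact_B i)).image_of_continuousOn
      ((𝒰.chart i).continuousOn_symm.mono (𝒰.closure_subset i))).isClosed
  rw [(𝒰.chart i).symm_image_eq_source_inter_preimage (𝒰.closure_subset i)] at hc
  refine (closure_minimal ?_ hc).trans inter_subset_left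
  rintro x hx
  exact ⟨hx.1, prod_mono subset_closure subset_closure hx.2⟩

end RegularAtlas

namespace HaefligerSuspension

variable {x₀ : M} {T : Set M} {X : Type*} [TopologicalSpace X]
  (H : F.HaefligerSuspension x₀ T X) {ι : Type*} (𝒰 : F.RegularAtlas ι) {K : Set X}

/-- The translates of `K` in the slices meet boundedly many plaques. -/
theorem exists_encard_plaques_le [T2Space M] [Finite ι] (hT : IsCompact T) (hK : IsCompact K) :
    ∃ N : ℕ, ∀ (z : M) (s : T),
      {Q | 𝒰.IsPlaque (F.leaf z) Q ∧ ∃ k ∈ K, H.toM (k, s) ∈ Q}.encard ≤ N := by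
  have : CompactSpace T := isCompact_iff_compactSpace.1 hT
  suffices h : ∃ N : ℕ, ∀ (z : M) (s : T), {Q | 𝒰.IsPlaque (F.leaf z) Q ∧
      ∃ k, (k, s) ∈ K ×ˢ (univ : Set T) ∧ H.toM (k, s) ∈ Q}.encard ≤ N by
    simpa using h
  refine (hK.prod isCompact_univ).induction_on (p := fun Z => ∃ N : ℕ, ∀ (z : M) (s : T),
    {Q | 𝒰.IsPlaque (F.leaf z) Q ∧ ∃ k, (k, s) ∈ Z ∧ H.toM (k, s) ∈ Q}.encard ≤ N) ⟨0, by simp⟩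
    (fun Z Z' hZ ⟨N, h⟩ => ⟨N, fun z s => (encard_le_encard ?_).trans (h z s)⟩)
    (fun Z Z' ⟨N, h⟩ ⟨N', h'⟩ => ⟨N + N', fun z s => ?_⟩) ?_
  · rintro Q ⟨hQ, k, hk, hkQ⟩
    exact ⟨hQ, k, hZ hk, hkQ⟩
  · rw [Nat.cast_add]
    refine (encard_le_encard ?_).trans ((encard_union_le _ _).trans (add_le_add (h z s) (h' z s)))
    rintro Q ⟨hQ, k, hk | hk, hkQ⟩
    · exact Or.inl ⟨hQ, k, hk, hkQ⟩
    · exact Or.inr ⟨hQ, k, hk, hkQ⟩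
  · rintro ⟨k, s⟩ -
    -- Near `(k, s)` each slice piece meets at most one plaque of each `Uᵢ`, so the local bound is
    -- the number of charts.
    have hloc : ∀ i, ∃ N ∈ 𝓝 (k, s), ∀ (z : M) (s' : T), {Q | (∃ x ∈ F.leaf z ∩ 𝒰.dom i,
        Q = 𝒰.plaque (F.leaf z) i x) ∧
        ∃ k', (k', s') ∈ N ∧ H.toM (k', s') ∈ Q}.Subsingleton := by
      intro i
      by_cases hks : H.toM (k, s) ∈ (𝒰.chart i).source
      · obtain ⟨V, -, hVo, hkV, W, hWo, hsW, h⟩ :=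
          H.exists_box (𝒰.foliated i) hks univ_mem
        refine ⟨V ×ˢ W, prod_mem_nhds (hVo.mem_nhds hkV) (hWo.mem_nhds hsW), fun z s' => ?_⟩
        rintro _ ⟨⟨x, hx, rfl⟩, k₁, hk₁, h₁⟩ _ ⟨⟨x', hx', rfl⟩, k₂, hk₂, h₂⟩
        exact 𝒰.plaque_eq_plaque hx hx' h₁ h₂ ((h s' hk₁.2 k₂ hk₂.1).2 k₁ hk₁.1)
      · refine ⟨H.toM ⁻¹' (closure (𝒰.dom i))ᶜ, (isClosed_closure.isOpen_compl.preimage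
          H.continuous_toM).mem_nhds fun h => hks (𝒰.closure_dom_subset_source i h), fun z s' => ?_⟩
        rintro _ ⟨⟨x, hx, rfl⟩, k₁, hk₁, h₁⟩
        exact (hk₁ (subset_closure ((𝒰.mem_plaque_iff hx).1 h₁).1)).elim
    choose N hN h using hloc
    refine ⟨⋂ i, N i, mem_nhdsWithin_of_mem_nhds (iInter_mem.2 hN), Nat.card ι, fun z s' => ?_⟩
    refine (encard_le_encard ?_).trans (encard_iUnion_le_card fun i => h i z s')
    rintro Q ⟨⟨i, x, hx, rfl⟩, k', hk', hQ⟩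
    exact mem_iUnion.2 ⟨i, ⟨x, hx, rfl⟩, k', mem_iInter.1 hk' i, hQ⟩

variable {H}

/-- Transport along the plaques of a finite regular atlas. -/
theorem exists_transport_plaque [T2Space M] [Finite ι] (hT : IsCompact T) (hK : IsCompact K)
    (hcov : ∀ x, ∃ g, ∃ k ∈ interior K, H.deck g k = x) :
    ∃ A : Set (FundamentalGroup (F.Leaf x₀) (F.basePoint x₀)), A.Finite ∧
      ∀ (z : M) (Q : Set M), 𝒰.IsPlaque (F.leaf z) Q → ∀ y ∈ Q, ∀ y' ∈ Q,
        H.Transport K A y y' := by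
  -- The compact closed boxes give one finite set for each `i`, valid for all plaques of `Uᵢ` at
  -- once.
  choose A hA h using fun i => exists_transport_box (H := H) hT hK hcov (𝒰.foliated i)
    (𝒰.isCompact_A i) (𝒰.isConnected_A i).isPreconnected.closure (𝒰.isCompact_B i)
    (𝒰.closure_subset i)
  refine ⟨⋃ i, A i, finite_iUnion hA, ?_⟩
  rintro z _ ⟨i, x, hx, rfl⟩ y hy y' hy'
  obtain ⟨hy, hyx⟩ := (𝒰.mem_plaque_iff hx).1 hy
  obtain ⟨hy', hyx'⟩ := (𝒰.mem_plaque_iff hx).1 hy'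
  have := h i (𝒰.chart i x).2 (subset_closure hx.2.2.2) (𝒰.chart i y).1
    (subset_closure hy.2.1) (𝒰.chart i y').1 (subset_closure hy'.2.1)
  nth_rw 1 [← hyx] at this
  rw [← hyx', Prod.mk.eta, Prod.mk.eta, (𝒰.chart i).left_inv hy.1,
    (𝒰.chart i).left_inv hy'.1] at this
  exact this.mono (subset_iUnion A i)

theorem exists_deck_of_isPlaquePath {A : Set (FundamentalGroup (F.Leaf x₀) (F.basePoint x₀))}
    (h1 : 1 ∈ A) {L : Set M} {t : T}
    (hA : ∀ Q : Set M, 𝒰.IsPlaque L Q → ∀ y ∈ Q, ∀ y' ∈ Q, H.Transport K A y y')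
    {c : List (Set M)} {P Q : Set M} (hc : 𝒰.IsPlaquePath L c) (hP : c.head? = some P)
    (hQ : c.getLast? = some Q) {g : FundamentalGroup (F.Leaf x₀) (F.basePoint x₀)}
    (hg : ∃ k ∈ K, H.toM (H.deck g k, t) ∈ P) :
    ∃ w ∈ A ^ c.length, ∃ k ∈ K, H.toM (H.deck (g * w) k, t) ∈ Q := by
  induction c generalizing P g with
  | nil => simp at hP
  | cons P' c ih =>
    obtain rfl : P' = P := by simpa using hP
    cases c with
    | nil =>
      obtain rfl : P' = Q := by simpa using hQ
      -- A path of length `l` needs only `l - 1` transports; `1 ∈ A` absorbs the spare factor of `A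
      -- ^ l`.
      exact ⟨1, by simpa using h1, by simpa using hg⟩
    | cons R c =>
      obtain ⟨hpl, hch⟩ := hc
      rw [List.isChain_cons_cons] at hch
      obtain ⟨⟨y, hyP, hyR⟩, hch⟩ := hch
      obtain ⟨k, hk, hkP⟩ := hg
      obtain ⟨a, ha, k', hk', e⟩ := (hA P' (hpl P' (by simp)) _ hkP y hyP).apply_deck g hk rfl
      obtain ⟨w, hw, hwQ⟩ := ih ⟨fun Q hQ => hpl Q (List.mem_cons_of_mem _ hQ), hch⟩ rfl
        (by simpa using hQ) (g := g * a) ⟨k', hk', e ▸ hyR⟩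
      refine ⟨a * w, ?_, by rwa [← mul_assoc]⟩
      rw [List.length_cons, pow_succ']
      exact mul_mem_mul ha hw

end HaefligerSuspension

end Foliation

/-! ### The growth estimate -/

open Foliation in
theorem proposition2p1 {p q : ℕ} {M : Type*} [TopologicalSpace M] [T2Space M] [CompactSpace M]
    (F : Foliation p q M) (x₀ : M) (hL₀ : CompactSpace (F.Leaf x₀))
    (T : Set M) (hT : F.IsTransversalAt T x₀) (hTconn : IsConnected T) (hTcomp : IsCompact T)
    {X : Type*} [TopologicalSpace X] [SimplyConnectedSpace X]
    (H : F.HaefligerSuspension x₀ T X) :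
    Group.FG (FundamentalGroup (F.Leaf x₀) (F.basePoint x₀)) ∧
    ∀ x ∈ H.nbhd,
    ∀ {ι : Type*} [Finite ι] (𝒰 : F.RegularAtlas ι) (P : Set M), 𝒰.IsPlaque (F.leaf x) P →
    ∀ S : Set (FundamentalGroup (F.Leaf x₀) (F.basePoint x₀)),
      S.Finite → Subgroup.closure S = ⊤ →
      GrowthLE (𝒰.growth (F.leaf x) P) (wordGrowth S) := by
  refine ⟨H.fundamentalGroup_fg hT.mem, ?_⟩
  rintro _ ⟨⟨u, t⟩, rfl⟩ ι _ 𝒰 P hP S hS hSG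
  obtain ⟨K, hK, hcov⟩ := H.exists_isCompact_cover hT.mem
  obtain ⟨N, hN⟩ := H.exists_encard_plaques_le 𝒰 hTcomp hK
  obtain ⟨A, hA, hAtr⟩ := HaefligerSuspension.exists_transport_plaque (H := H) 𝒰 hTcomp hK hcov
  obtain ⟨b, hb⟩ := exists_subset_insert_one_pow hSG hA
  -- A starting tile for `P`: the slice over `t` maps onto the whole leaf, so `P` has a preimage in
  -- some `gK × {t}`.
  obtain ⟨g, hg⟩ : ∃ g, ∃ k ∈ K, H.toM (H.deck g k, t) ∈ P := by
    obtain ⟨i, x, hx, rfl⟩ := hP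
    obtain ⟨v, rfl⟩ := H.leaf_subset_range hTcomp hK hcov u t hx.1
    obtain ⟨g, k, hk, rfl⟩ := hcov v
    exact ⟨g, k, interior_subset hk, 𝒰.self_mem_plaque hx⟩
  refine ⟨N, b, fun n => ?_⟩
  set E := (insert 1 (S ∪ S⁻¹) : Set (FundamentalGroup (F.Leaf x₀) (F.basePoint x₀))) with hE
  -- `E ^ b` replaces `A` as the transport set. As it contains `1`, a path shorter than `n` still
  -- gives an element of `(E ^ b) ^ n`.
  have h1 : 1 ∈ E ^ b := Set.one_mem_pow (mem_insert _ _)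
  have hfin : (E ^ (b * n)).Finite := finite_insert_one_pow hS _
  refine (encard_le_encard ?_).trans (hfin.encard_biUnion_le_mul (fun w =>
    {Q | 𝒰.IsPlaque (F.leaf (H.toM (u, t))) Q ∧
      ∃ k ∈ K, H.toM (k, H.hol (g * w)⁻¹ t) ∈ Q}) N fun w _ => hN _ _)
  rintro Q ⟨c, hc, hcn, hcP, hcQ⟩
  obtain ⟨w, hw, k, hk, hkQ⟩ := HaefligerSuspension.exists_deck_of_isPlaquePath (K := K) (t := t) 𝒰 h1
    (fun Q hQ y hy y' hy' => (hAtr _ Q hQ y hy y' hy').mono hb) hc hcP hcQ hg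
  rw [H.toM_deck] at hkQ
  refine mem_iUnion₂.2 ⟨w, ?_, hc.1 Q (List.mem_of_getLast? hcQ), k, hk, hkQ⟩
  rw [pow_mul]
  exact pow_subset_pow_right h1 hcn hw
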